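/- Let $r$ and $q$ be positive integers and let $\mathsf k$ be a field. For an ideal $J$ of a polynomial ring $R$ in finitely many variables over $\mathsf k$, the $i$-th Betti number $\beta_i^R(J)$ is the smallest possible rank of the free module $F_i$ in a free resolution $0\to F_t\to\cdots\to F_1\to F_0\to J\to 0$ of $J$ by free $R$-modules of finite rank. Let $$S_{\mathcal E}=\mathsf k[x_A : \emptyset\ne A\subseteq\{1,\dots,q\}]$$ be the polynomial ring in $2^q-1$ variables, let $\epsilon_j=\prod_{A\subseteq\{1,\dots,q\},\ j\in A}x_A$ for $1\le j\le q$, and let $\mathcal E_q=(\epsilon_1,\dots,\epsilon_q)\subseteq S_{\mathcal E}$ be the $q$-extremal ideal. Then for every $n\ge 0$, every ideal $I$ of $S=\mathsf k[x_1,\dots,x_n]$ that is minimally generated by $q$ square-free monomials (that is, generated by $q$ square-free monomials none of which can be omitted), and every $i\ge 0$, $$\beta_i^S(I^r)\le\beta_i^{S_{\mathcal E}}({\mathcal E_q}^r).$$ -/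

import Mathlib

open MvPolynomial

/-- A (finite) free resolution of an `R`-module `M`, i.e. an exact sequence
`0 → R^{β_t} → ⋯ → R^{β_1} → R^{β_0} → M → 0`.
The module in spot `j` is `R^{rank j}`; it is zero for all large `j`, so that exactness in every
spot includes the injectivity of the leftmost map. -/
structure FreeResolution (R : Type*) [CommRing R] (M : Type*) [AddCommGroup M] [Module R M] where
  /-- the rank `β_j` of the free module in spot `j` -/
  rank : ℕ → ℕ
  /-- the differential from spot `j + 1` to spot `j` -/
  d : ∀ j : ℕ, (Fin (rank (j + 1)) → R) →ₗ[R] (Fin (rank j) → R)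
  /-- the augmentation `R^{β_0} → M` -/
  aug : (Fin (rank 0) → R) →ₗ[R] M
  aug_surjective : Function.Surjective aug
  exact_zero : Function.Exact (d 0) aug
  exact_succ : ∀ j : ℕ, Function.Exact (d (j + 1)) (d j)
  finite_length : ∃ t : ℕ, ∀ j : ℕ, t < j → rank j = 0

/-- The `i`-th Betti number `β_i^R(M)`: the smallest possible rank of the free module in the
`i`-th spot of any free resolution of `M`.  (Over a polynomial ring over a field every finitely
generated module has a free resolution, so there the infimum is an attained minimum.  For a
homogeneous ideal all these minima are attained by one and the same resolution, the minimal one.) -/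
noncomputable def bettiNumber (R : Type*) [CommRing R] (M : Type*) [AddCommGroup M] [Module R M]
    (i : ℕ) : ℕ :=
  sInf {b : ℕ | ∃ F : FreeResolution R M, F.rank i = b}

/-- A square-free monomial: a product of pairwise distinct variables. -/
def IsSquarefreeMonomial {σ k : Type*} [CommRing k] (p : MvPolynomial σ k) : Prop :=
  ∃ s : Finset σ, p = ∏ x ∈ s, X x

/-- The ideal `I` is minimally generated by `q` square-free monomials `m_1, …, m_q`:
they generate `I`, and none of them can be left out. -/
def IsMinimallyGeneratedBySquarefreeMonomials {σ k : Type*} [CommRing k]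
    (I : Ideal (MvPolynomial σ k)) (q : ℕ) : Prop :=
  ∃ m : Fin q → MvPolynomial σ k,
    (∀ j, IsSquarefreeMonomial (m j)) ∧
    Ideal.span (Set.range m) = I ∧
    ∀ j, Ideal.span (m '' {j}ᶜ) ≠ I

/-- The index set of the variables `x_A`, `∅ ≠ A ⊆ [q]`. -/
abbrev ExtremalVar (q : ℕ) : Type := {A : Finset (Fin q) // A.Nonempty}

/-- The ring `S_E = k[x_A : ∅ ≠ A ⊆ [q]]`. -/
abbrev ExtremalRing (k : Type*) [Field k] (q : ℕ) : Type _ := MvPolynomial (ExtremalVar q) k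

/-- The square-free monomial `ε_i = ∏_{A ∋ i} x_A`. -/
noncomputable def extremalMonomial (k : Type*) [Field k] (q : ℕ) (i : Fin q) : ExtremalRing k q :=
  ∏ A : ExtremalVar q with i ∈ A.1, X A

/-- The `q`-extremal ideal `E_q = (ε_1, …, ε_q)`. -/
noncomputable def extremalIdeal (k : Type*) [Field k] (q : ℕ) : Ideal (ExtremalRing k q) :=
  Ideal.span (Set.range (extremalMonomial k q))

-- Let m_1, …, m_q generate I. Send x_A to the product of those variables x for which A is exactly
-- the set of j with x ∣ m_j. Then ε_j ↦ m_j, so I^r is the extension of E_q^r, and the images of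
-- distinct x_A have disjoint supports (`exists_map_extremalIdeal_eq`).
--
-- Such a substitution turns any free resolution of a monomial ideal into one of the extended ideal,
-- with the same ranks (`FreeResolution.exists_of_monomial_substitution`). It factors as k[x] →
-- k[x,y] → k[y]. The first map is flat. The second kills the elements x_A - y^(u A) one at a time.
-- Each is a nonzerodivisor both on the ring and modulo the current monomial ideal, by disjointness
-- of supports (`mem_monomialIdeal_of_X_sub_monomial_mul_mem`), so exactness survives
-- (`ExactModKer.comp`). The quotients are modelled by idempotent endomorphisms of k[x,y].
--
-- Applied to a resolution of E_q^r with smallest i-th rank, this gives the inequality. That a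
-- resolution exists at all is `exists_hasFiniteFreeResolution_monomialIdeal`.

universe u

/-! ### Finite free resolutions through iterated syzygies -/

/-- `M` has a free resolution by finite free modules, of length less than `n`. -/
def HasFiniteFreeResolution (R : Type u) [CommRing R] :
    ℕ → ∀ (M : Type u) [AddCommGroup M] [Module R M], Prop
  | 0, M, _, _ => Subsingleton M
  | n + 1, M, _, _ => ∃ (m : ℕ) (f : (Fin m → R) →ₗ[R] M), Function.Surjective f ∧
      HasFiniteFreeResolution R n (LinearMap.ker f)

namespace HasFiniteFreeResolution

variable {R : Type u} [CommRing R]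

theorem of_subsingleton (M : Type u) [AddCommGroup M] [Module R M] [h : Subsingleton M] :
    HasFiniteFreeResolution R 0 M := h

theorem of_equiv {n : ℕ} {M N : Type u} [AddCommGroup M] [Module R M] [AddCommGroup N]
    [Module R N] (e : M ≃ₗ[R] N) (h : HasFiniteFreeResolution R n M) :
    HasFiniteFreeResolution R n N := by
  induction n generalizing M N with
  | zero =>
    have : Subsingleton M := h
    have : Subsingleton N := e.symm.injective.subsingleton
    exact of_subsingleton N
  | succ n ih =>
    obtain ⟨m, f, hf, hk⟩ := h
    refine ⟨m, e.toLinearMap ∘ₗ f, e.surjective.comp hf, ?_⟩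
    rw [LinearEquiv.ker_comp]
    exact hk

theorem succ {n : ℕ} {M : Type u} [AddCommGroup M] [Module R M]
    (h : HasFiniteFreeResolution R n M) : HasFiniteFreeResolution R (n + 1) M := by
  induction n generalizing M with
  | zero =>
    have : Subsingleton M := h
    refine ⟨0, 0, fun x => ⟨0, Subsingleton.elim _ _⟩, ?_⟩
    exact of_subsingleton _
  | succ n ih =>
    obtain ⟨m, f, hf, hk⟩ := h
    exact ⟨m, f, hf, ih hk⟩

theorem mono {m n : ℕ} (hmn : m ≤ n) {M : Type u} [AddCommGroup M] [Module R M]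
    (h : HasFiniteFreeResolution R m M) : HasFiniteFreeResolution R n M := by
  induction n, hmn using Nat.le_induction with
  | base => exact h
  | succ n _ ih => exact ih.succ

theorem of_free (m : ℕ) : HasFiniteFreeResolution R 1 (Fin m → R) := by
  refine ⟨m, LinearMap.id, Function.surjective_id, ?_⟩
  rw [LinearMap.ker_id]
  exact of_subsingleton _

/-- The horseshoe lemma. -/
theorem of_extension {n : ℕ} {B C : Type u} [AddCommGroup B] [Module R B] [AddCommGroup C]
    [Module R C] (f : B →ₗ[R] C) (hf : Function.Surjective f)
    (hA : HasFiniteFreeResolution R n (LinearMap.ker f)) (hC : HasFiniteFreeResolution R n C) :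
    HasFiniteFreeResolution R n B := by
  induction n generalizing B C with
  | zero =>
    have hA : Subsingleton (LinearMap.ker f) := hA
    have hC : Subsingleton C := hC
    have key : ∀ x : B, x = 0 := fun x => congrArg Subtype.val
      (Subsingleton.elim (⟨x, Subsingleton.elim _ _⟩ : LinearMap.ker f) 0)
    exact (⟨fun x y => (key x).trans (key y).symm⟩ : Subsingleton B)
  | succ n ih =>
    obtain ⟨a, α, hα, hkα⟩ := hA
    obtain ⟨c, γ, hγ, hkγ⟩ := hC
    obtain ⟨γ', hγ'⟩ := Module.projective_lifting_property f γ hf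
    have hγ'' : ∀ x, f (γ' x) = γ x := fun x => LinearMap.congr_fun hγ' x
    let e : (Fin (a + c) → R) ≃ₗ[R] (Fin a → R) × (Fin c → R) :=
      (LinearEquiv.funCongrLeft R R finSumFinEquiv).trans
        (LinearEquiv.sumArrowLequivProdArrow _ _ R R)
    let β : (Fin a → R) × (Fin c → R) →ₗ[R] B :=
      LinearMap.coprod ((LinearMap.ker f).subtype ∘ₗ α) γ'
    have hβ : Function.Surjective β := by
      intro b
      obtain ⟨y, hy⟩ := hγ (f b)
      obtain ⟨x, hx⟩ := hα ⟨b - γ' y, by simp [hγ'', hy]⟩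
      exact ⟨(x, y), by simp [β, hx]⟩
    refine ⟨a + c, β ∘ₗ e.toLinearMap, hβ.comp e.surjective, ?_⟩
    have hfβ : ∀ z, f (β z) = γ z.2 := by
      intro z
      simp [β, hγ'']
    -- The syzygies of `B` are an extension of `ker γ` by `ker α`, to which induction applies.
    let p : LinearMap.ker (β ∘ₗ e.toLinearMap) →ₗ[R] LinearMap.ker γ :=
      ((LinearMap.snd R _ _ ∘ₗ e.toLinearMap) ∘ₗ Submodule.subtype _).codRestrict _ (by
        rintro ⟨z, hz⟩
        have hz : β (e z) = 0 := hz
        have := hfβ (e z)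
        rw [hz, map_zero] at this
        exact this.symm)
    refine ih p ?_ ?_ hkγ
    · rintro ⟨y, hy⟩
      have hy : γ y = 0 := hy
      obtain ⟨x, hx⟩ := hα ⟨-γ' y, by simp [hγ'', hy]⟩
      refine ⟨⟨e.symm (x, y), ?_⟩, ?_⟩
      · simp [β, hx]
      · ext1
        simp [p]
    · let i : LinearMap.ker α →ₗ[R] LinearMap.ker p :=
        LinearMap.codRestrict _ (LinearMap.codRestrict _
          ((e.symm.toLinearMap ∘ₗ LinearMap.inl R _ _) ∘ₗ Submodule.subtype _)
            (by rintro ⟨x, hx⟩; have hx : α x = 0 := hx; simp [β, hx]))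
            (by rintro ⟨x, hx⟩; ext1; simp [p])
      refine of_equiv (LinearEquiv.ofBijective i ⟨?_, ?_⟩) hkα
      · rintro ⟨x, hx⟩ ⟨y, hy⟩ hxy
        have h1 : e.symm (x, 0) = e.symm (y, 0) :=
          congrArg (fun z => z.1.1) hxy
        have := e.symm.injective h1
        exact Subtype.ext (Prod.ext_iff.1 this).1
      · rintro ⟨⟨z, hz⟩, hz'⟩
        have hz' : (e z).2 = 0 := congrArg Subtype.val hz'
        have hz : β (e z) = 0 := hz
        have hze : e z = ((e z).1, 0) := Prod.ext rfl hz'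
        have hα0 : α (e z).1 = 0 := by
          rw [hze] at hz
          ext1
          simpa [β] using hz
        refine ⟨⟨(e z).1, hα0⟩, ?_⟩
        ext1; ext1
        change e.symm ((e z).1, 0) = z
        rw [← hze, LinearEquiv.symm_apply_apply]

theorem of_quotient {n : ℕ} {B C : Type u} [AddCommGroup B] [Module R B] [AddCommGroup C]
    [Module R C] (f : B →ₗ[R] C) (hf : Function.Surjective f)
    (hA : HasFiniteFreeResolution R n (LinearMap.ker f)) (hB : HasFiniteFreeResolution R n B) :
    HasFiniteFreeResolution R (n + 1) C := by
  -- Raising the bound to `n + 1` gives `ker g` the bound `n`, the same as `ker f`; the kernel of `f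
  -- ∘ g` is an extension of `ker f` by `ker g`.
  obtain ⟨m, g, hg, hk⟩ := hB.succ
  refine ⟨m, f ∘ₗ g, hf.comp hg, ?_⟩
  let p : LinearMap.ker (f ∘ₗ g) →ₗ[R] LinearMap.ker f :=
    (g ∘ₗ Submodule.subtype _).codRestrict _ fun z => z.2
  refine of_extension p ?_ ?_ hA
  · rintro ⟨b, hb⟩
    obtain ⟨z, rfl⟩ := hg b
    exact ⟨⟨z, hb⟩, rfl⟩
  · let i : LinearMap.ker g →ₗ[R] LinearMap.ker p :=
      LinearMap.codRestrict _ (LinearMap.codRestrict _ (Submodule.subtype _)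
        (by rintro ⟨x, hx⟩; have hx : g x = 0 := hx; simp [hx]))
        (by rintro ⟨x, hx⟩; ext1; exact hx)
    refine of_equiv (LinearEquiv.ofBijective i ⟨?_, ?_⟩) hk
    · rintro ⟨x, hx⟩ ⟨y, hy⟩ hxy
      exact Subtype.ext (congrArg (fun z => z.1.1) hxy)
    · rintro ⟨⟨z, hz⟩, hz'⟩
      exact ⟨⟨z, congrArg Subtype.val hz'⟩, rfl⟩

theorem nonempty_freeResolution {n : ℕ} {M : Type u} [AddCommGroup M] [Module R M]
    (h : HasFiniteFreeResolution R n M) : Nonempty (FreeResolution R M) := by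
  induction n generalizing M with
  | zero =>
    have : Subsingleton M := h
    exact ⟨{
      rank := fun _ => 0
      d := fun _ => 0
      aug := 0
      aug_surjective := fun x => ⟨0, Subsingleton.elim _ _⟩
      exact_zero := fun x => ⟨fun _ => ⟨0, Subsingleton.elim _ _⟩, fun _ => Subsingleton.elim _ _⟩
      exact_succ := fun _ x =>
        ⟨fun _ => ⟨0, Subsingleton.elim _ _⟩, fun _ => Subsingleton.elim _ _⟩
      finite_length := ⟨0, fun _ _ => rfl⟩ }⟩
  | succ n ih =>
    obtain ⟨m, f, hf, hk⟩ := h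
    obtain ⟨G⟩ := ih hk
    refine ⟨{
      rank := fun j => Nat.casesOn j m G.rank
      d := fun j => match j with
        | 0 => Submodule.subtype _ ∘ₗ G.aug
        | j + 1 => G.d j
      aug := f
      aug_surjective := hf
      exact_zero := ?_
      exact_succ := ?_
      finite_length := ?_ }⟩
    · intro x
      constructor
      · intro hx
        obtain ⟨z, hz⟩ := G.aug_surjective ⟨x, hx⟩
        exact ⟨z, congrArg Subtype.val hz⟩
      · rintro ⟨z, rfl⟩
        exact (G.aug z).2
    · rintro (_ | j)
      · exact fun x => (Subtype.ext_iff.symm.trans (G.exact_zero x))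
      · exact G.exact_succ j
    · obtain ⟨t, ht⟩ := G.finite_length
      refine ⟨t + 1, ?_⟩
      rintro (_ | j) hj
      · omega
      · exact ht j (by omega)

end HasFiniteFreeResolution

/-! ### Monomial ideals and their resolutions -/

/-- The ideal generated by the monomials with exponents in `s`. -/
noncomputable def monomialIdeal (k : Type*) [CommSemiring k] {σ : Type*} (s : Set (σ →₀ ℕ)) :
    Ideal (MvPolynomial σ k) :=
  Ideal.span ((fun e => monomial e (1 : k)) '' s)

theorem mem_monomialIdeal {k σ : Type*} [CommSemiring k] {s : Set (σ →₀ ℕ)}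
    {p : MvPolynomial σ k} :
    p ∈ monomialIdeal k s ↔ ∀ e ∈ p.support, ∃ g ∈ s, g ≤ e :=
  mem_ideal_span_monomial_image

/-- Being divisible by two monomials means being divisible by their lcm. The number of generators
does not grow, which makes induction on it possible. -/
theorem monomialIdeal_inf_span_monomial {k σ : Type*} [Field k] (s : Set (σ →₀ ℕ)) (e : σ →₀ ℕ) :
    monomialIdeal k s ⊓ Ideal.span {monomial e (1 : k)} =
      monomialIdeal k ((fun g => g ⊔ e) '' s) := by
  have : Ideal.span {monomial e (1 : k)} = monomialIdeal k {e} := by simp [monomialIdeal]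
  ext p
  rw [this, Submodule.mem_inf, mem_monomialIdeal, mem_monomialIdeal, mem_monomialIdeal]
  constructor
  · rintro ⟨h1, h2⟩ x hx
    obtain ⟨g, hg, hgx⟩ := h1 x hx
    obtain ⟨_, rfl, hex⟩ := h2 x hx
    exact ⟨_, ⟨g, hg, rfl⟩, sup_le hgx hex⟩
  · intro h
    refine ⟨fun x hx => ?_, fun x hx => ?_⟩
    · obtain ⟨_, ⟨g, hg, rfl⟩, hgx⟩ := h x hx
      exact ⟨g, hg, le_sup_left.trans hgx⟩
    · obtain ⟨_, ⟨g, hg, rfl⟩, hgx⟩ := h x hx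
      exact ⟨e, rfl, le_sup_right.trans hgx⟩

theorem monomialIdeal_insert {k σ : Type*} [CommSemiring k] (s : Set (σ →₀ ℕ)) (e : σ →₀ ℕ) :
    monomialIdeal k (insert e s) = monomialIdeal k s ⊔ Ideal.span {monomial e (1 : k)} := by
  rw [monomialIdeal, Set.image_insert_eq, Ideal.span_insert, sup_comm]
  rfl

/-- This comes from the exact sequence 0 → I ∩ J → I × J → I + J → 0, with x ↦ (x, -x) on the left.
-/
theorem hasFiniteFreeResolution_sup {R : Type u} [CommRing R] {n : ℕ} (I J : Ideal R)
    (hI : HasFiniteFreeResolution R n I) (hJ : HasFiniteFreeResolution R n J)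
    (hIJ : HasFiniteFreeResolution R n ↥(I ⊓ J)) :
    HasFiniteFreeResolution R (n + 1) ↥(I ⊔ J) := by
  have hprod : HasFiniteFreeResolution R n (I × J) := by
    refine .of_extension (LinearMap.snd R I J) Prod.snd_surjective ?_ hJ
    let i : I →ₗ[R] LinearMap.ker (LinearMap.snd R I J) :=
      (LinearMap.inl R I J).codRestrict _ fun x => rfl
    refine .of_equiv (LinearEquiv.ofBijective i ⟨?_, ?_⟩) hI
    · intro x y hxy
      exact congrArg (fun z => z.1.1) hxy
    · rintro ⟨⟨x, y⟩, hy⟩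
      have hy : y = 0 := hy
      subst hy
      exact ⟨x, rfl⟩
  let f : (I × J) →ₗ[R] ↥(I ⊔ J) :=
    (LinearMap.coprod I.subtype J.subtype).codRestrict _ fun z =>
      Submodule.add_mem_sup z.1.2 z.2.2
  refine .of_quotient f ?_ ?_ hprod
  · rintro ⟨x, hx⟩
    obtain ⟨y, hy, z, hz, rfl⟩ := Submodule.mem_sup.1 hx
    exact ⟨(⟨y, hy⟩, ⟨z, hz⟩), rfl⟩
  · let i : ↥(I ⊓ J) →ₗ[R] LinearMap.ker f :=
      (LinearMap.prod (Submodule.inclusion inf_le_left)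
        (-Submodule.inclusion inf_le_right)).codRestrict _ (by
          rintro ⟨x, hx⟩
          exact Subtype.ext (add_neg_cancel x))
    refine .of_equiv (LinearEquiv.ofBijective i ⟨?_, ?_⟩) hIJ
    · intro x y hxy
      exact Subtype.ext (congrArg (fun z => z.1.1.1) hxy)
    · rintro ⟨⟨⟨x, hx⟩, ⟨y, hy⟩⟩, h⟩
      have h : x + y = 0 := congrArg Subtype.val h
      obtain rfl := eq_neg_of_add_eq_zero_right h
      exact ⟨⟨x, hx, by simpa using hy⟩, rfl⟩

theorem hasFiniteFreeResolution_span_singleton {R : Type u} [CommRing R] [IsDomain R] {x : R}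
    (hx : x ≠ 0) : HasFiniteFreeResolution R 1 (Ideal.span {x}) :=
  .of_equiv ((LinearEquiv.funUnique (Fin 1) R R).trans
    (LinearEquiv.toSpanNonzeroSingleton R R x hx)) (.of_free 1)

/-- A finitely generated monomial ideal has a finite free resolution. -/
theorem exists_hasFiniteFreeResolution_monomialIdeal {σ k : Type*} [Field k]
    (s : Set (σ →₀ ℕ)) (hs : s.Finite) :
    ∃ n, HasFiniteFreeResolution (MvPolynomial σ k) n (monomialIdeal k s) := by
  -- Induction on an upper bound, since distinct generators may have the same lcm with `e`.
  obtain ⟨N, hN⟩ : ∃ N, s.ncard ≤ N := ⟨_, le_rfl⟩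
  induction N generalizing s with
  | zero =>
    have : s = ∅ := (Set.ncard_eq_zero hs).1 (by omega)
    subst this
    refine ⟨0, ?_⟩
    rw [monomialIdeal, Set.image_empty, Ideal.span_empty]
    exact .of_subsingleton _
  | succ N ih =>
    rcases s.eq_empty_or_nonempty with rfl | ⟨e, he⟩
    · exact ih ∅ hs (by simp)
    · have hs' : (s \ {e}).Finite := hs.sdiff
      have hc : (s \ {e}).ncard ≤ N := by
        have := Set.ncard_sdiff_singleton_add_one he hs
        omega
      obtain ⟨a, ha⟩ := ih (s \ {e}) hs' hc
      obtain ⟨b, hb⟩ := ih ((fun g => g ⊔ e) '' (s \ {e})) (hs'.image _)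
        ((Set.ncard_image_le hs').trans hc)
      have h1 : HasFiniteFreeResolution (MvPolynomial σ k) 1
          (Ideal.span {monomial e (1 : k)}) :=
        hasFiniteFreeResolution_span_singleton (by simp)
      rw [← monomialIdeal_inf_span_monomial] at hb
      have := hasFiniteFreeResolution_sup _ _ (ha.mono (n := a + b + 1) (by omega))
        (h1.mono (by omega)) (hb.mono (by omega))
      rw [← monomialIdeal_insert, Set.insert_sdiff_singleton, Set.insert_eq_of_mem he] at this
      exact ⟨_, this⟩

/-! ### Base change of exact sequences of free modules -/

section BaseChange

/-- The base change of a map of finite free modules along a ring homomorphism, obtained by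
applying the ring homomorphism to the entries of the matrix. -/
noncomputable def LinearMap.piBaseChange {R S : Type*} [CommRing R] [CommRing S] (φ : R →+* S)
    {α β : Type*} [Fintype α] [DecidableEq α] (d : (α → R) →ₗ[R] (β → R)) :
    (α → S) →ₗ[S] (β → S) :=
  Matrix.toLin' ((LinearMap.toMatrix' d).map φ)

variable {R S : Type*} [CommRing R] [CommRing S] (φ : R →+* S)
variable {α β γ δ : Type}

theorem LinearMap.piBaseChange_comp_apply [Fintype α] [DecidableEq α] (d : (α → R) →ₗ[R] (β → R)) (z : α → R) :
    d.piBaseChange φ (φ ∘ z) = φ ∘ d z := by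
  ext i
  rw [LinearMap.piBaseChange, Matrix.toLin'_apply, ← RingHom.map_mulVec,
    LinearMap.toMatrix'_mulVec]
  rfl

theorem LinearMap.comp_apply_congr [Fintype α] [DecidableEq α] (d : (α → R) →ₗ[R] (β → R)) {z w : α → R}
    (h : φ ∘ z = φ ∘ w) : φ ∘ d z = φ ∘ d w := by
  rw [← d.piBaseChange_comp_apply, h, d.piBaseChange_comp_apply]

/-- `L → M → N` becomes exact in the middle after passing to the image of `φ`. -/
def ExactModKer (d₁ : (α → R) →ₗ[R] (β → R)) (d₂ : (β → R) →ₗ[R] (δ → R)) : Prop :=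
  ∀ z, φ ∘ d₂ z = 0 → ∃ w, φ ∘ z = φ ∘ d₁ w

theorem ExactModKer.exact [Fintype α] [DecidableEq α] [Fintype β] [DecidableEq β]
    {φ : R →+* S} (hφ : Function.Surjective φ)
    {d₁ : (α → R) →ₗ[R] (β → R)} {d₂ : (β → R) →ₗ[R] (δ → R)}
    (hc : ∀ z, d₂ (d₁ z) = 0) (h : ExactModKer φ d₁ d₂) :
    Function.Exact (d₁.piBaseChange φ) (d₂.piBaseChange φ) := by
  intro z
  constructor
  · intro hz
    obtain ⟨z, rfl⟩ := hφ.comp_left z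
    rw [LinearMap.piBaseChange_comp_apply] at hz
    obtain ⟨w, hw⟩ := h z hz
    exact ⟨φ ∘ w, (d₁.piBaseChange_comp_apply φ w).trans hw.symm⟩
  · rintro ⟨w, rfl⟩
    obtain ⟨w, rfl⟩ := hφ.comp_left w
    rw [LinearMap.piBaseChange_comp_apply, LinearMap.piBaseChange_comp_apply, hc]
    ext
    simp

/-- Applying `φ` to matrix entries is tensoring with `S`, up to the identification of `S ⊗ R^ι` with
`S^ι`. -/
theorem RingHom.Flat.exact_piBaseChange [Fintype α] [DecidableEq α] [Fintype β] [DecidableEq β]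
    [Fintype γ] [DecidableEq γ] {φ : R →+* S} (hφ : φ.Flat)
    {d₁ : (α → R) →ₗ[R] (β → R)} {d₂ : (β → R) →ₗ[R] (γ → R)} (h : Function.Exact d₁ d₂) :
    Function.Exact (d₁.piBaseChange φ) (d₂.piBaseChange φ) := by
  algebraize [φ]
  have key : ∀ {ι κ : Type} [Fintype ι] [DecidableEq ι] [Fintype κ] [DecidableEq κ]
      (d : (ι → R) →ₗ[R] (κ → R)) (x : TensorProduct R S (ι → R)),
      d.piBaseChange φ (TensorProduct.piScalarRight R S S ι x) =
        TensorProduct.piScalarRight R S S κ (d.lTensor S x) := by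
    intro ι κ _ _ _ _ d x
    induction x with
    | zero => simp
    | add x y hx hy => simp only [map_add, hx, hy]
    | tmul s v =>
      have hs : ∀ {ι : Type} [Fintype ι] [DecidableEq ι] (v : ι → R),
          TensorProduct.piScalarRight R S S ι (s ⊗ₜ v) = s • (φ ∘ v) := by
        intro ι _ _ v
        ext i
        simp [TensorProduct.piScalarRight_apply, Algebra.smul_def, RingHom.algebraMap_toAlgebra,
          mul_comm]
      rw [LinearMap.lTensor_tmul, hs, hs, map_smul, LinearMap.piBaseChange_comp_apply]
  have hex := Module.Flat.lTensor_exact S h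
  intro z
  obtain ⟨x, rfl⟩ := (TensorProduct.piScalarRight R S S β).surjective z
  rw [key, LinearEquiv.map_eq_zero_iff, hex x]
  constructor
  · rintro ⟨w, rfl⟩
    exact ⟨_, key d₁ w⟩
  · rintro ⟨w, hw⟩
    obtain ⟨w, rfl⟩ := (TensorProduct.piScalarRight R S S α).surjective w
    rw [key] at hw
    exact ⟨w, (TensorProduct.piScalarRight R S S β).injective hw⟩

/-- Passing from `P / ker φ` to `P / ker (ψ ∘ φ)`, where `ker ψ` is generated by an element that is
not a zero divisor modulo `ker φ`. -/
theorem ExactModKer.comp {φ ψ : R →+* R} (hφ : ∀ x, φ (φ x) = φ x) {f : R} (hf : φ f = f)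
    (hψ : ∀ x, ψ x = 0 → ∃ y, x = f * y) (hψf : ψ f = 0)
    {d₁ : (α → R) →ₗ[R] (β → R)} {d₂ : (β → R) →ₗ[R] (γ → R)}
    (h : ExactModKer φ d₁ d₂)
    (hlift : ∀ w : γ → R, (∃ z, f • (φ ∘ w) = φ ∘ d₂ z) → ∃ z, φ ∘ w = φ ∘ d₂ z) :
    ExactModKer (ψ.comp φ) d₁ d₂ := by
  intro z hz
  choose y hy using fun i => hψ (φ (d₂ z i)) (congrFun hz i)
  have hy' : φ ∘ d₂ z = f • (φ ∘ y) := by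
    ext i
    have := congrArg φ (hy i)
    rw [hφ, map_mul, hf] at this
    exact this
  obtain ⟨v, hv⟩ := hlift y ⟨z, hy'.symm⟩
  -- The correction `f • v` brings `z` into the scope of `h` and is invisible in the end, because `ψ
  -- f = 0`.
  have h0 : φ ∘ d₂ (z - f • v) = 0 := by
    ext i
    have h1 := congrFun hy' i
    have h2 := congrFun hv i
    simp only [Function.comp_apply, Pi.smul_apply, smul_eq_mul] at h1 h2
    simp [hf, h1, h2]
  obtain ⟨w, hw⟩ := h _ h0
  refine ⟨w, ?_⟩
  ext i
  have := congrArg ψ (congrFun hw i)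
  simpa [hf, hψf] using this

/-- If `f • w` is a boundary modulo `ker φ`, then `f` kills `φ ∘ d₃ w`. As `f` is a nonzerodivisor,
`w` is a cycle, hence a boundary by `h'`. -/
theorem ExactModKer.comp_of_exact [Fintype γ] [DecidableEq γ]
    {φ ψ : R →+* R} (hφ : ∀ x, φ (φ x) = φ x) {f : R} (hf : φ f = f)
    (hψ : ∀ x, ψ x = 0 → ∃ y, x = f * y) (hψf : ψ f = 0) (hreg : ∀ x, f * x = 0 → x = 0)
    {d₁ : (α → R) →ₗ[R] (β → R)} {d₂ : (β → R) →ₗ[R] (γ → R)} {d₃ : (γ → R) →ₗ[R] (δ → R)}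
    (h : ExactModKer φ d₁ d₂) (h' : ExactModKer φ d₂ d₃) (hc : ∀ z, d₃ (d₂ z) = 0) :
    ExactModKer (ψ.comp φ) d₁ d₂ := by
  refine h.comp hφ hf hψ hψf ?_
  rintro w ⟨z, hz⟩
  refine h' w ?_
  have h1 : φ ∘ (f • w) = φ ∘ d₂ z := by
    rw [← hz]
    ext i
    simp [hf]
  have h2 := d₃.comp_apply_congr φ h1
  ext i
  have h3 := congrFun h2 i
  simp only [hc, map_smul, Function.comp_apply, Pi.smul_apply, smul_eq_mul, map_mul, hf,
    Pi.zero_apply, map_zero] at h3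
  exact hreg _ h3

end BaseChange

/-- Idempotency gives `φ (r * φ y) = φ (r * y)`, so coefficients outside the image of `φ` can be
absorbed into `J`. -/
theorem exists_eq_of_mem_map_of_idempotent {R : Type*} [CommRing R] {J : Ideal R} {φ : R →+* R}
    (hφ : ∀ x, φ (φ x) = φ x) {x : R} (hx : x ∈ J.map φ) : ∃ y ∈ J, φ y = φ x := by
  induction hx using Submodule.span_induction with
  | mem x hx =>
    obtain ⟨y, hy, rfl⟩ := hx
    exact ⟨y, hy, (hφ y).symm⟩
  | zero => exact ⟨0, J.zero_mem, rfl⟩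
  | add x x' _ _ h h' =>
    obtain ⟨y, hy, hyx⟩ := h
    obtain ⟨y', hy', hyx'⟩ := h'
    exact ⟨y + y', J.add_mem hy hy', by simp [hyx, hyx']⟩
  | smul r x _ h =>
    obtain ⟨y, hy, hyx⟩ := h
    exact ⟨r * y, J.mul_mem_left r hy, by simp [hyx]⟩

/-! ### Base change of resolutions of ideals -/

namespace FreeResolution

variable {R : Type*} [CommRing R] {J : Ideal R} (F : FreeResolution R J)

/-- The augmentation of a free resolution of an ideal, as a map to the free module of rank one. -/
def augPi : (Fin (F.rank 0) → R) →ₗ[R] (Unit → R) :=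
  LinearMap.pi fun _ => J.subtype ∘ₗ F.aug

theorem augPi_apply (z : Fin (F.rank 0) → R) (i : Unit) : F.augPi z i = (F.aug z : R) := rfl

theorem exact_augPi : Function.Exact (F.d 0) F.augPi := by
  intro z
  rw [← F.exact_zero z]
  constructor
  · intro h
    exact Subtype.ext (congrFun h ())
  · intro h
    ext i
    simp [augPi_apply, h]

/-- The augmentation is a row matrix whose entries generate `J`; their images under `φ` generate the
extended ideal. -/
theorem map_eq_range {S : Type*} [CommRing S] (φ : R →+* S) :
    J.map φ = LinearMap.range (LinearMap.proj () ∘ₗ F.augPi.piBaseChange φ) := by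
  apply le_antisymm
  · refine Ideal.map_le_iff_le_comap.2 fun x hx => ?_
    obtain ⟨z, hz⟩ := F.aug_surjective ⟨x, hx⟩
    refine ⟨φ ∘ z, ?_⟩
    simp [LinearMap.piBaseChange_comp_apply, augPi_apply, hz]
  · rintro _ ⟨z, rfl⟩
    rw [LinearMap.comp_apply, LinearMap.pi_apply_eq_sum_univ (F.augPi.piBaseChange φ), map_sum]
    refine Ideal.sum_mem _ fun i _ => ?_
    have : (fun j => if i = j then (1 : S) else 0) = φ ∘ fun j => if i = j then (1 : R) else 0 := by
      ext j
      simp [apply_ite φ]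
    rw [this, LinearMap.piBaseChange_comp_apply]
    exact Ideal.mul_mem_left _ _ (Ideal.mem_map_of_mem _ (F.aug _).2)

/-- If base change along `φ` keeps a free resolution of an ideal `J` exact, then the result
is a free resolution of the extension of `J`. -/
theorem exists_baseChange {S : Type*} [CommRing S] (φ : R →+* S)
    (h0 : Function.Exact ((F.d 0).piBaseChange φ) (F.augPi.piBaseChange φ))
    (hs : ∀ j, Function.Exact ((F.d (j + 1)).piBaseChange φ) ((F.d j).piBaseChange φ)) :
    ∃ G : FreeResolution S (J.map φ), G.rank = F.rank := by
  refine ⟨{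
    rank := F.rank
    d := fun j => (F.d j).piBaseChange φ
    aug := (LinearMap.proj () ∘ₗ F.augPi.piBaseChange φ).codRestrict _ fun z => by
      rw [F.map_eq_range φ]
      exact ⟨z, rfl⟩
    aug_surjective := ?_
    exact_zero := ?_
    exact_succ := hs
    finite_length := F.finite_length }, rfl⟩
  · rintro ⟨x, hx⟩
    have hx' := hx
    rw [F.map_eq_range φ] at hx'
    obtain ⟨z, rfl⟩ := hx'
    exact ⟨z, rfl⟩
  · intro z
    rw [← h0 z]
    constructor
    · intro h
      ext i
      exact congrArg Subtype.val h
    · intro h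
      exact Subtype.ext (congrFun h ())

theorem exists_baseChange_of_flat {S : Type*} [CommRing S] {φ : R →+* S} (hφ : φ.Flat) :
    ∃ G : FreeResolution S (J.map φ), G.rank = F.rank :=
  F.exists_baseChange φ (hφ.exact_piBaseChange F.exact_augPi)
    fun j => hφ.exact_piBaseChange (F.exact_succ j)

/-- The resolution stays exact modulo the kernel of `φ`. -/
def ExactModKer {S : Type*} [CommRing S] (φ : R →+* S) : Prop :=
  _root_.ExactModKer φ (F.d 0) F.augPi ∧ ∀ j, _root_.ExactModKer φ (F.d (j + 1)) (F.d j)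

theorem exists_baseChange_of_surjective {S : Type*} [CommRing S] {φ : R →+* S}
    (hφ : Function.Surjective φ) (h : F.ExactModKer φ) :
    ∃ G : FreeResolution S (J.map φ), G.rank = F.rank :=
  F.exists_baseChange φ (h.1.exact hφ F.exact_augPi.apply_apply_eq_zero)
    fun j => (h.2 j).exact hφ (F.exact_succ j).apply_apply_eq_zero

theorem exactModKer_id : F.ExactModKer (RingHom.id R) := by
  refine ⟨fun z hz => ?_, fun j z hz => ?_⟩
  · obtain ⟨w, rfl⟩ := (F.exact_augPi z).1 hz
    exact ⟨w, rfl⟩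
  · obtain ⟨w, rfl⟩ := (F.exact_succ j z).1 hz
    exact ⟨w, rfl⟩

-- Regularity of `f` modulo the extended ideal is needed only next to the augmentation; in all other
-- spots regularity on the ring is enough.
variable {F} in
theorem ExactModKer.comp {φ ψ : R →+* R} (hφ : ∀ x, φ (φ x) = φ x) {f : R} (hf : φ f = f)
    (hψ : ∀ x, ψ x = 0 → ∃ y, x = f * y) (hψf : ψ f = 0) (hreg : ∀ x, f * x = 0 → x = 0)
    (hregJ : ∀ x, f * x ∈ J.map φ → x ∈ J.map φ) (h : F.ExactModKer φ) :
    F.ExactModKer (ψ.comp φ) := by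
  refine ⟨h.1.comp hφ hf hψ hψf ?_, ?_⟩
  · rintro w ⟨z, hz⟩
    have h1 : f * φ (w ()) = φ (F.aug z) := congrFun hz ()
    have h2 : φ (w ()) ∈ J.map φ := hregJ _ (h1 ▸ Ideal.mem_map_of_mem φ (F.aug z).2)
    obtain ⟨y, hy, hyw⟩ := exists_eq_of_mem_map_of_idempotent hφ h2
    obtain ⟨z, hz⟩ := F.aug_surjective ⟨y, hy⟩
    refine ⟨z, ?_⟩
    ext i
    simp [augPi_apply, hz, hyw, hφ]
  · rintro (_ | j)
    · exact (h.2 0).comp_of_exact hφ hf hψ hψf hreg h.1 F.exact_augPi.apply_apply_eq_zero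
    · exact (h.2 (j + 1)).comp_of_exact hφ hf hψ hψf hreg (h.2 j)
        (F.exact_succ j).apply_apply_eq_zero

end FreeResolution

/-! ### Substituting monomials with disjoint supports -/

section Substitution

variable {k σ τ ρ : Type*} [Field k]

/-- Multiplication by `x_a - y^u` is injective modulo a monomial ideal whose generators
do not involve the variables of `y^u`. -/
theorem mem_monomialIdeal_of_X_sub_monomial_mul_mem {s : Set (σ →₀ ℕ)} {a : σ} {u : σ →₀ ℕ}
    (hu : ∀ g ∈ s, ∀ v, u v ≠ 0 → g v = 0) (hua : u a = 0) {p : MvPolynomial σ k}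
    (hp : (X a - monomial u 1) * p ∈ monomialIdeal k s) : p ∈ monomialIdeal k s := by
  classical
  -- The generators avoid the variables of `y^u`, so the factor `y^u` does not help divisibility.
  have hsat : ∀ e, (∃ g ∈ s, g ≤ e + u) → ∃ g ∈ s, g ≤ e := by
    rintro e ⟨g, hg, hge⟩
    refine ⟨g, hg, fun v => ?_⟩
    by_cases hv : u v = 0
    · simpa [hv] using hge v
    · simp [hu g hg v hv]
  rw [mem_monomialIdeal] at hp ⊢
  -- Induction on the exponent of `x_a`. Either `e + u` survives in the product, or it is cancelled
  -- by `x_a` times a term of `p` with smaller `x_a`-exponent.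
  have main : ∀ n, ∀ e ∈ p.support, e a = n → ∃ g ∈ s, g ≤ e := by
    intro n
    induction n using Nat.strong_induction_on with
    | _ n ih =>
      intro e he hen
      apply hsat
      by_cases h : e + u ∈ ((X a - monomial u 1) * p).support
      · exact hp _ h
      · rw [notMem_support_iff, sub_mul, coeff_sub, add_comm e u, coeff_monomial_mul, one_mul,
          coeff_X_mul', sub_eq_zero] at h
        have hne : coeff e p ≠ 0 := mem_support_iff.1 he
        split_ifs at h with ha
        · have hpos : (u + e) a ≠ 0 := Finsupp.mem_support_iff.1 ha
          rw [Finsupp.add_apply, hua, zero_add] at hpos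
          obtain ⟨g, hg, hge⟩ := ih (n - 1) (by omega) (u + e - Finsupp.single a 1)
            (mem_support_iff.2 (h ▸ hne)) (by simp [hua, hen])
          exact ⟨g, hg, hge.trans (by rw [add_comm e u]; exact tsub_le_self)⟩
        · exact absurd h.symm hne
  exact fun e he => main _ e he rfl

variable [DecidableEq τ] (u : τ → ρ →₀ ℕ) (T : Finset τ)

/-- The exponent of the image of a variable under `partialSubst`. -/
noncomputable def partialSubstExponent : τ ⊕ ρ → (τ ⊕ ρ →₀ ℕ) :=
  Sum.elim (fun a => if a ∈ T then (u a).mapDomain Sum.inr else Finsupp.single (Sum.inl a) 1)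
    fun b => Finsupp.single (Sum.inr b) 1

/-- The endomorphism of `k[x_a, y_b]` sending `x_a` to the monomial `y ^ u a` for `a ∈ T` and
fixing the other variables. -/
noncomputable def partialSubst (k : Type*) [Field k] :
    MvPolynomial (τ ⊕ ρ) k →ₐ[k] MvPolynomial (τ ⊕ ρ) k :=
  aeval fun v => monomial (partialSubstExponent u T v) 1

theorem aeval_monomial_eq {σ' : Type*} (f : σ → σ' →₀ ℕ) (e : σ →₀ ℕ) :
    aeval (fun v => monomial (f v) (1 : k)) (monomial e (1 : k)) =
      monomial (e.sum fun v n => n • f v) 1 := by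
  rw [aeval_monomial, map_one, one_mul, Finsupp.prod, Finsupp.sum, monomial_sum_one]
  exact Finset.prod_congr rfl fun v _ => by rw [monomial_pow, one_pow]

theorem map_monomialIdeal {σ' : Type*} (f : σ → σ' →₀ ℕ) (s : Set (σ →₀ ℕ)) :
    (monomialIdeal k s).map (aeval fun v => monomial (f v) (1 : k)) =
      monomialIdeal k ((fun e => e.sum fun v n => n • f v) '' s) := by
  rw [monomialIdeal, monomialIdeal, Ideal.map_span, Set.image_image, Set.image_image]
  exact congrArg _ (Set.image_congr fun e _ => aeval_monomial_eq f e)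

theorem partialSubst_X_inl_of_mem {a : τ} (ha : a ∈ T) :
    partialSubst u T k (X (Sum.inl a)) = monomial ((u a).mapDomain Sum.inr) 1 := by
  simp [partialSubst, partialSubstExponent, ha]

theorem partialSubst_X_inl_of_notMem {a : τ} (ha : a ∉ T) :
    partialSubst u T k (X (Sum.inl a)) = X (Sum.inl a) := by
  rw [partialSubst, aeval_X, partialSubstExponent, Sum.elim_inl, if_neg ha]
  rfl

theorem partialSubst_X_inr (b : ρ) :
    partialSubst u T k (X (Sum.inr b)) = X (Sum.inr b) := by
  rw [partialSubst, aeval_X]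
  rfl

theorem partialSubst_rename_inr (p : MvPolynomial ρ k) :
    partialSubst u T k (rename Sum.inr p) = rename Sum.inr p := by
  have : (partialSubst u T k).comp (rename Sum.inr) = rename Sum.inr := by
    ext b
    simp [partialSubst_X_inr]
  exact DFunLike.congr_fun this p

theorem partialSubst_monomial_mapDomain_inr (e : ρ →₀ ℕ) :
    partialSubst u T k (monomial (e.mapDomain Sum.inr) 1) = monomial (e.mapDomain Sum.inr) 1 := by
  rw [← rename_monomial, partialSubst_rename_inr]

theorem partialSubst_partialSubst (p : MvPolynomial (τ ⊕ ρ) k) :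
    partialSubst u T k (partialSubst u T k p) = partialSubst u T k p := by
  have : (partialSubst u T k).comp (partialSubst u T k) = partialSubst u T k := by
    ext (a | b)
    · by_cases ha : a ∈ T
      · simp [partialSubst_X_inl_of_mem u T ha, partialSubst_monomial_mapDomain_inr]
      · simp [partialSubst_X_inl_of_notMem u T ha]
    · simp [partialSubst_X_inr]
  exact DFunLike.congr_fun this p

theorem partialSubst_insert (a : τ) :
    partialSubst u (insert a T) k = (partialSubst u {a} k).comp (partialSubst u T k) := by
  ext (b | b)
  · by_cases hb : b ∈ T
    · simp [partialSubst_X_inl_of_mem u T hb, partialSubst_monomial_mapDomain_inr,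
        partialSubst_X_inl_of_mem u _ (Finset.mem_insert_of_mem hb)]
    · by_cases hba : b = a
      · subst hba
        simp [partialSubst_X_inl_of_notMem u T hb,
          partialSubst_X_inl_of_mem u _ (Finset.mem_insert_self b T),
          partialSubst_X_inl_of_mem u _ (Finset.mem_singleton_self b)]
      · simp [partialSubst_X_inl_of_notMem u T hb,
          partialSubst_X_inl_of_notMem u (insert a T) (a := b) (by simp [hb, hba]),
          partialSubst_X_inl_of_notMem u {a} (a := b) (by simp [hba])]
  · simp [partialSubst_X_inr]

theorem partialSubst_empty : partialSubst u ∅ k = AlgHom.id k _ := by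
  ext (a | b)
  · simp [partialSubst_X_inl_of_notMem u ∅ (a := a) (by simp)]
  · simp [partialSubst_X_inr]

/-- Modulo `f` the substitution is the identity, so whatever it kills is zero modulo `f`. -/
theorem exists_eq_mul_of_partialSubst_singleton_eq_zero (a : τ) {p : MvPolynomial (τ ⊕ ρ) k}
    (hp : partialSubst u {a} k p = 0) :
    ∃ y, p = (X (Sum.inl a) - monomial ((u a).mapDomain Sum.inr) 1) * y := by
  set f : MvPolynomial (τ ⊕ ρ) k := X (Sum.inl a) - monomial ((u a).mapDomain Sum.inr) 1 with hf
  have : (Ideal.Quotient.mkₐ k (Ideal.span {f})).comp (partialSubst u {a} k) =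
      Ideal.Quotient.mkₐ k (Ideal.span {f}) := by
    ext (b | b)
    · by_cases hba : b = a
      · subst hba
        rw [AlgHom.comp_apply, partialSubst_X_inl_of_mem u _ (Finset.mem_singleton_self b)]
        refine (Ideal.Quotient.eq.2 ?_).symm
        exact Ideal.mem_span_singleton_self f
      · rw [AlgHom.comp_apply, partialSubst_X_inl_of_notMem u _ (by simpa using hba)]
    · rw [AlgHom.comp_apply, partialSubst_X_inr]
  have h := DFunLike.congr_fun this p
  rw [AlgHom.comp_apply, hp, map_zero] at h
  exact Ideal.mem_span_singleton.1 (Ideal.Quotient.eq_zero_iff_mem.1 h.symm)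

variable {u} in
/-- A free resolution of the extension of a monomial ideal of `k[x_a]` to `k[x_a, y_b]` stays exact
modulo the `x_a - y ^ u a`, if the monomials `y ^ u a` have pairwise disjoint supports. -/
theorem exactModKer_partialSubst (hu : ∀ a a' b, a ≠ a' → u a b ≠ 0 → u a' b = 0)
    (s : Set (τ →₀ ℕ)) {J : Ideal (MvPolynomial (τ ⊕ ρ) k)}
    (hJ : J = (monomialIdeal k s).map (rename Sum.inl)) (F : FreeResolution _ J) :
    F.ExactModKer (partialSubst u T k).toRingHom := by
  induction T using Finset.induction_on with
  | empty =>
    rw [partialSubst_empty]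
    exact F.exactModKer_id
  | insert a T ha ih =>
    rw [partialSubst_insert]
    -- After the substitutions for `T` the ideal is still monomial, and its generators involve only
    -- the `y`-variables of the `u v` with `v ∈ T`.
    have hmap : J.map (partialSubst u T k).toRingHom = monomialIdeal k
        ((fun e => e.sum fun v n => n • partialSubstExponent u T (Sum.inl v)) '' s) := by
      rw [hJ, ← map_monomialIdeal]
      change Ideal.map (partialSubst u T k).toRingHom
        (Ideal.map (rename Sum.inl : _ →ₐ[k] MvPolynomial (τ ⊕ ρ) k).toRingHom _) = _
      rw [Ideal.map_map]
      have : (partialSubst u T k).comp (rename Sum.inl) =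
          aeval fun v => monomial (partialSubstExponent u T (Sum.inl v)) (1 : k) := by
        ext v
        simp [partialSubst]
      rw [← this]
      rfl
    have hua : ((u a).mapDomain Sum.inr : τ ⊕ ρ →₀ ℕ) (Sum.inl a) = 0 :=
      Finsupp.mapDomain_of_notMem_range _ _ (by simp)
    have hreg : ∀ {t : Set (τ ⊕ ρ →₀ ℕ)}, (∀ g ∈ t, ∀ b, u a b ≠ 0 → g (Sum.inr b) = 0) →
        ∀ {p : MvPolynomial (τ ⊕ ρ) k},
        (X (Sum.inl a) - monomial ((u a).mapDomain Sum.inr) 1) * p ∈ monomialIdeal k t →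
        p ∈ monomialIdeal k t := by
      intro t ht p
      refine mem_monomialIdeal_of_X_sub_monomial_mul_mem ?_ hua
      rintro g hg (v | v) hv
      · exact absurd (Finsupp.mapDomain_of_notMem_range _ _ (by simp)) hv
      · rw [Finsupp.mapDomain_apply Sum.inr_injective] at hv
        exact ht g hg v hv
    refine ih.comp (ψ := (partialSubst u {a} k).toRingHom)
      (partialSubst_partialSubst u T)
      (f := X (Sum.inl a) - monomial ((u a).mapDomain Sum.inr) 1) ?_
      (fun x hx => exists_eq_mul_of_partialSubst_singleton_eq_zero u a hx) ?_ ?_ ?_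
    · simp [partialSubst_X_inl_of_notMem u T ha, partialSubst_monomial_mapDomain_inr]
    · simp [partialSubst_X_inl_of_mem u {a} (Finset.mem_singleton_self a),
        partialSubst_monomial_mapDomain_inr]
    · intro x hx
      -- With no generators the monomial ideal is zero, so this is regularity on the ring itself.
      have := hreg (t := ∅) (by simp) (p := x) (by rw [hx]; exact Ideal.zero_mem _)
      simpa [monomialIdeal] using this
    · intro x hx
      replace hx : _ ∈ J.map (partialSubst u T k).toRingHom := hx
      change x ∈ J.map (partialSubst u T k).toRingHom
      rw [hmap] at hx ⊢
      refine hreg ?_ hx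
      rintro _ ⟨e, -, rfl⟩ b hb
      rw [Finsupp.sum_apply]
      refine Finset.sum_eq_zero fun v _ => ?_
      by_cases hv : v ∈ T
      · have hne : a ≠ v := fun h => ha (h ▸ hv)
        simp [partialSubstExponent, hv, Finsupp.mapDomain_apply Sum.inr_injective,
          hu a v b hne hb]
      · simp [partialSubstExponent, hv]

/-- k[x,y] is a polynomial ring over k[x], hence flat. -/
theorem flat_rename_inl {k τ ρ : Type*} [Field k] :
    (rename Sum.inl : MvPolynomial τ k →ₐ[k] MvPolynomial (τ ⊕ ρ) k).toRingHom.Flat := by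
  have h1 : (C : MvPolynomial τ k →+* MvPolynomial ρ (MvPolynomial τ k)).Flat :=
    RingHom.flat_algebraMap_iff.2 inferInstance
  have h2 := h1.comp (RingHom.Flat.of_bijective (f := RingEquiv.toRingHom ((sumRingEquiv k ρ τ).symm.trans
    (renameEquiv k (Equiv.sumComm ρ τ)).toRingEquiv))
    (RingEquiv.bijective _))
  convert h2 using 1
  ext v <;> simp [sumRingEquiv_symm_C_C, sumRingEquiv_symm_C_X]


variable {u} in
/-- Substituting monomials with pairwise disjoint supports (possibly `1`) for the variables
turns any free resolution of a monomial ideal into one of the extended ideal. -/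
theorem FreeResolution.exists_of_monomial_substitution [Finite τ]
    (hu : ∀ a a' b, a ≠ a' → u a b ≠ 0 → u a' b = 0) (s : Set (τ →₀ ℕ))
    {J : Ideal (MvPolynomial τ k)} (hJ : J = monomialIdeal k s) (F : FreeResolution (MvPolynomial τ k) J) :
    ∃ G : FreeResolution (MvPolynomial ρ k)
      (J.map (aeval fun a => monomial (u a) (1 : k) : MvPolynomial τ k →ₐ[k] _)),
      G.rank = F.rank := by
  have := Fintype.ofFinite τ
  obtain ⟨G, hG⟩ := F.exists_baseChange_of_flat (flat_rename_inl (τ := τ) (ρ := ρ) (k := k))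
  have hex := exactModKer_partialSubst Finset.univ hu s (by rw [hJ]; rfl) G
  let π : MvPolynomial (τ ⊕ ρ) k →ₐ[k] MvPolynomial ρ k :=
    aeval (Sum.elim (fun a => monomial (u a) 1) X)
  have hπ : (rename Sum.inr).comp π = partialSubst u Finset.univ k := by
    ext (a | b)
    · simp [π, partialSubst_X_inl_of_mem u _ (Finset.mem_univ a), rename_monomial]
    · simp [π, partialSubst_X_inr]
  have hπinl : π.comp (rename Sum.inl) = aeval fun a => monomial (u a) (1 : k) := by
    ext a
    simp [π]
  have hsurj : Function.Surjective π := by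
    have : π.comp (rename Sum.inr) = AlgHom.id k _ := by
      ext b
      simp [π]
    exact fun p => ⟨rename Sum.inr p, DFunLike.congr_fun this p⟩
  have hinj := rename_injective (R := k) (Sum.inr : ρ → τ ⊕ ρ) Sum.inr_injective
  have hπ' : ∀ {ι : Type} (z : ι → MvPolynomial (τ ⊕ ρ) k),
      (partialSubst u Finset.univ k) ∘ z = rename Sum.inr ∘ π ∘ z := by
    intro ι z
    rw [← hπ]
    rfl
  -- `π` and the full substitution have the same kernel, since they differ by the injective `rename
  -- Sum.inr`.
  have hexπ : G.ExactModKer π.toRingHom := by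
    have key : ∀ {α β γ : Type} {d₁ : (α → MvPolynomial (τ ⊕ ρ) k) →ₗ[_] (β → _)}
        {d₂ : (β → MvPolynomial (τ ⊕ ρ) k) →ₗ[MvPolynomial (τ ⊕ ρ) k] (γ → _)},
        _root_.ExactModKer (partialSubst u Finset.univ k).toRingHom d₁ d₂ →
        _root_.ExactModKer π.toRingHom d₁ d₂ := by
      intro α β γ d₁ d₂ h z hz
      obtain ⟨w, hw⟩ := h z (by
        refine (hπ' _).trans ?_
        ext i
        have : π (d₂ z i) = 0 := congrFun hz i
        simp [this])
      exact ⟨w, hinj.comp_left ((hπ' _).symm.trans (hw.trans (hπ' _)))⟩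
    exact ⟨key hex.1, fun j => key (hex.2 j)⟩
  obtain ⟨H, hH⟩ := G.exists_baseChange_of_surjective (φ := π.toRingHom) hsurj hexπ
  have heq : (J.map (rename Sum.inl : _ →ₐ[k] MvPolynomial (τ ⊕ ρ) k).toRingHom).map π.toRingHom =
      J.map (aeval fun a => monomial (u a) (1 : k) : MvPolynomial τ k →ₐ[k] _) := by
    rw [Ideal.map_map, ← hπinl]
    rfl
  rw [← heq]
  exact ⟨H, hH.trans hG⟩

end Substitution

/-! ### Powers of the extremal ideal and the comparison -/

theorem monomialIdeal_mul {k σ : Type*} [CommSemiring k] (s t : Set (σ →₀ ℕ)) :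
    monomialIdeal k s * monomialIdeal k t = monomialIdeal k (Set.image2 (· + ·) s t) := by
  rw [monomialIdeal, monomialIdeal, monomialIdeal, Ideal.span_mul_span', ← Set.image2_mul,
    Set.image2_image_left, Set.image2_image_right, Set.image_image2]
  simp only [monomial_mul, one_mul]

theorem exists_monomialIdeal_pow {k σ : Type*} [CommSemiring k] {s : Set (σ →₀ ℕ)} (hs : s.Finite)
    (r : ℕ) : ∃ t : Set (σ →₀ ℕ), t.Finite ∧ monomialIdeal k s ^ r = monomialIdeal k t := by
  induction r with
  | zero =>
    refine ⟨{0}, Set.finite_singleton 0, ?_⟩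
    rw [pow_zero, monomialIdeal, Set.image_singleton, ← one_def, Ideal.span_singleton_one,
      Ideal.one_eq_top]
  | succ r ih =>
    obtain ⟨t, ht, h⟩ := ih
    exact ⟨_, ht.image2 _ hs, by rw [pow_succ, h, monomialIdeal_mul]⟩

theorem prod_X_eq_monomial {k σ : Type*} [CommSemiring k] (s : Finset σ) :
    ∏ x ∈ s, (X x : MvPolynomial σ k) = monomial (∑ x ∈ s, Finsupp.single x 1) 1 := by
  rw [monomial_sum_one]
  rfl

theorem exists_extremalIdeal_pow_eq_monomialIdeal (k : Type*) [Field k] (q r : ℕ) :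
    ∃ s : Set (ExtremalVar q →₀ ℕ), s.Finite ∧ extremalIdeal k q ^ r = monomialIdeal k s := by
  have h : extremalIdeal k q = monomialIdeal k (Set.range fun i : Fin q =>
      ∑ A : ExtremalVar q with i ∈ A.1, Finsupp.single A 1) := by
    rw [extremalIdeal, monomialIdeal, ← Set.range_comp]
    exact congrArg _ (congrArg _ (funext fun i => prod_X_eq_monomial _))
  rw [h]
  exact exists_monomialIdeal_pow (Set.finite_range _) r

/-- Every ideal generated by `q` square-free monomials is the extension of the extremal ideal along
a substitution of square-free monomials with pairwise disjoint supports. -/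
theorem exists_map_extremalIdeal_eq {k : Type*} [Field k] {q : ℕ} {σ : Type*} [Fintype σ]
    {I : Ideal (MvPolynomial σ k)} (hI : IsMinimallyGeneratedBySquarefreeMonomials I q) :
    ∃ u : ExtremalVar q → σ →₀ ℕ, (∀ A A' b, A ≠ A' → u A b ≠ 0 → u A' b = 0) ∧
      (extremalIdeal k q).map
        (aeval fun A => monomial (u A) (1 : k) : ExtremalRing k q →ₐ[k] MvPolynomial σ k) = I := by
  classical
  obtain ⟨m, hm, rfl, -⟩ := hI
  choose s hs using hm
  -- Each variable has just one pattern, whence the disjoint supports. An `x_A` whose pattern does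
  -- not occur goes to 1.
  let pat : σ → Finset (Fin q) := fun x => {j | x ∈ s j}
  have hpat : ∀ x j, j ∈ pat x ↔ x ∈ s j := by simp [pat]
  refine ⟨fun A => ∑ x with pat x = A.1, Finsupp.single x 1, ?_, ?_⟩
  · intro A A' b hne hA
    have hval : ∀ B : ExtremalVar q,
        (∑ x with pat x = B.1, Finsupp.single x 1 : σ →₀ ℕ) b = if pat b = B.1 then 1 else 0 := by
      intro B
      simp [Finsupp.finsetSum_apply, Finsupp.single_apply]
    simp only [hval] at hA ⊢
    rw [if_neg]
    intro h
    apply hA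
    rw [if_neg]
    exact fun h' => hne (Subtype.ext (h'.symm.trans h))
  · rw [extremalIdeal, Ideal.map_span, ← Set.range_comp]
    refine congrArg _ (congrArg _ (funext fun j => ?_))
    rw [Function.comp_apply, extremalMonomial, map_prod, hs j]
    simp only [aeval_X, ← prod_X_eq_monomial]
    rw [Finset.prod_sigma']
    -- Pairs (A, x) with `j ∈ A` and `pat x = A` correspond to the variables `x` of `m j`; the
    -- pattern is nonempty as it contains `j`.
    refine Finset.prod_bij' (fun p _ => p.2)
      (fun x hx => ⟨⟨pat x, ⟨j, (hpat x j).2 (by assumption)⟩⟩, x⟩) ?_ ?_ ?_ ?_ ?_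
    · rintro ⟨A, x⟩ h
      simp only [Finset.mem_sigma, Finset.mem_filter, Finset.mem_univ, true_and] at h
      exact (hpat x j).1 (h.2 ▸ h.1)
    · intro x hx
      simpa [hpat] using hx
    · rintro ⟨⟨A, hA⟩, x⟩ h
      simp only [Finset.mem_sigma, Finset.mem_filter, Finset.mem_univ, true_and] at h
      obtain rfl : pat x = A := h.2
      rfl
    · intro x hx
      rfl
    · intro p hp
      rfl

theorem theorem7p6 (k : Type*) [Field k] (r q : ℕ) (hr : 0 < r) (hq : 0 < q)
    (n : ℕ) (I : Ideal (MvPolynomial (Fin n) k))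
    (hI : IsMinimallyGeneratedBySquarefreeMonomials I q) (i : ℕ) :
    bettiNumber (MvPolynomial (Fin n) k) ↥(I ^ r) i ≤
      bettiNumber (ExtremalRing k q) ↥(extremalIdeal k q ^ r) i := by
  obtain ⟨s, hsfin, hs⟩ := exists_extremalIdeal_pow_eq_monomialIdeal k q r
  obtain ⟨u, hu, rfl⟩ := exists_map_extremalIdeal_eq hI
  -- Without a resolution the infimum on the right would take the default value 0; nonemptiness
  -- makes it an attained minimum.
  have hne : {b : ℕ | ∃ F : FreeResolution (ExtremalRing k q) ↥(extremalIdeal k q ^ r),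
      F.rank i = b}.Nonempty := by
    rw [hs]
    obtain ⟨N, hN⟩ := exists_hasFiniteFreeResolution_monomialIdeal (k := k) s hsfin
    obtain ⟨F⟩ := hN.nonempty_freeResolution
    exact ⟨_, F, rfl⟩
  obtain ⟨F, hF⟩ := Nat.sInf_mem hne
  rw [← Ideal.map_pow]
  obtain ⟨G, hG⟩ := F.exists_of_monomial_substitution hu s hs
  refine Nat.sInf_le ⟨G, ?_⟩
  rw [hG]
  exact hF
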